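/- Let $\Delta$ be the set of probability distributions on $\mathbb R$ with finite variance, with the topology in which $F\to\Phi$ if and only if $\int\gamma\,dF\to\int\gamma\,d\Phi$ for every continuous $\gamma:\mathbb R\to\mathbb R$ such that $\gamma(x)/(1+x^2)$ is bounded (the topology of the 2-Wasserstein metric). Let $\Delta_0\subset\Delta$ be a fixed compact set, let $F_n\in\Delta_0$ be an arbitrary sequence, and for each $n$ let $X_{n,1},\ldots,X_{n,n}$ be independent random variables with common distribution $F_n$. Let $\delta$ be a fixed real number, and for each $n$ let $m_n=(m_{n,1},\ldots,m_{n,n})\in\mathbb R^n$ satisfy $\frac1n\sum_{j=1}^n m_{n,j}=0$ and $\sum_{j=1}^n m_{n,j}^2\le\delta^2$. Let $\hat F_n$ be the empirical distribution of $X_{n,1},\ldots,X_{n,n}$, and for a distribution $G$ on $\mathbb R$ write $\mathrm E_G\exp(i\tau\sum_j m_{n,j}Y_j)$ for the expectation when $Y_1,\ldots,Y_n$ are independent with distribution $G$ (for $G=\hat F_n$, the expectation is conditional on $X_{n,1},\ldots,X_{n,n}$). Then for each fixed $\tau\in\mathbb R$, $$\mathrm E_{\hat F_n}\exp\Bigl(i\tau\sum_{j=1}^n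 m_{n,j}Y_j\Bigr)-\mathrm E_{F_n}\exp\Bigl(i\tau\sum_{j=1}^n m_{n,j}Y_j\Bigr)\to 0$$ in probability as $n\to\infty$. -/

import Mathlib

open MeasureTheory ProbabilityTheory Filter Topology
open scoped ENNReal

/-- The space `Δ`: probability distributions on the real line with finite variance. -/
structure FiniteVarDist where
  /-- the distribution, as a Borel measure on `ℝ` -/
  law : Measure ℝ
  /-- it is a probability measure -/
  isProb : IsProbabilityMeasure law
  /-- it has a finite second moment -/
  sq_integrable : Integrable (fun x : ℝ => x ^ 2) law

/-- The continuous functions `γ : ℝ → ℝ` such that `γ x / (1 + x ^ 2)` is bounded. -/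
def QuadTestFun : Type :=
  {γ : ℝ → ℝ // Continuous γ ∧ ∃ C : ℝ, ∀ x, |γ x / (1 + x ^ 2)| ≤ C}

/-- The topology on `Δ` in which `F` converges to `Φ` iff `E_F γ → E_Φ γ` for every continuous
`γ` with `γ x / (1 + x ^ 2)` bounded (the topology of the 2-Wasserstein metric). -/
noncomputable instance FiniteVarDist.topologicalSpace : TopologicalSpace FiniteVarDist :=
  TopologicalSpace.induced
    (fun (F : FiniteVarDist) (γ : QuadTestFun) => ∫ x, γ.1 x ∂F.law) Pi.topologicalSpace

/-- The empirical distribution of the numbers `x 0, …, x (n - 1)`: mass `1 / n` at each. -/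
noncomputable def empiricalDist {n : ℕ} (x : Fin n → ℝ) : Measure ℝ :=
  (n : ℝ≥0∞)⁻¹ • ∑ i, Measure.dirac (x i)

/-- `E_G exp (i τ ∑ m_j Y_j)`, where `Y_1, …, Y_n` are independent with common distribution
`G`. -/
noncomputable def sumCharFun {n : ℕ} (G : Measure ℝ) (m : Fin n → ℝ) (τ : ℝ) : ℂ :=
  ∫ y : Fin n → ℝ, Complex.exp (Complex.I * τ * ((∑ j, m j * y j : ℝ) : ℂ))
    ∂(Measure.pi fun _ : Fin n => G)

/-- A sequence of random quantities, the `n`-th one defined on the probability space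
`(Ω n, P n)`, tends to `0` in probability. -/
def TendstoZeroInProb {Ω : ℕ → Type*} [∀ n, MeasurableSpace (Ω n)]
    (P : ∀ n, Measure (Ω n)) (Z : ∀ n, Ω n → ℂ) : Prop :=
  ∀ ε : ℝ, 0 < ε → Tendsto (fun n => P n {ω | ε ≤ ‖Z n ω‖}) atTop (𝓝 0)

/-! Since the weights sum to zero, the linear statistic is unchanged when all variables are shifted
by a constant, so under each law it may be centred at that law's own mean. Its characteristic
function is then a product of n factors `1 + ∫ expRem (τ m_j (x - mean))`, with no first-order term.
All factors have modulus at most 1, so two such products differ by at most the sum of the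
differences of their factors.

Each difference is `(τ m_j) ^ 2` times a random quantity whose expectation is small uniformly in j,
and `∑ m_j ^ 2 ≤ δ ^ 2` makes the sum small. That quantity has two sources: replacing the sample
mean by the true mean (`norm_average_expRem_recenter_le`), and averaging a function of quadratic
growth over the sample (`integral_abs_average_sub_le`). The second is a law of large numbers in
mean, needed uniformly because `F n` varies; compactness supplies it as uniform integrability of the
centred squares. Markov's inequality concludes. -/

/-! ### Products of complex numbers and the Taylor remainder -/

theorem norm_prod_sub_prod_le {ι : Type*} (s : Finset ι) (a b : ι → ℂ)
    (ha : ∀ i ∈ s, ‖a i‖ ≤ 1) (hb : ∀ i ∈ s, ‖b i‖ ≤ 1) :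
    ‖∏ i ∈ s, a i - ∏ i ∈ s, b i‖ ≤ ∑ i ∈ s, ‖a i - b i‖ := by
  classical
  induction s using Finset.induction_on with
  | empty => simp
  | insert i s hi ih =>
    rw [Finset.prod_insert hi, Finset.prod_insert hi, Finset.sum_insert hi]
    have ih' := ih (fun j hj => ha j (Finset.mem_insert_of_mem hj))
      (fun j hj => hb j (Finset.mem_insert_of_mem hj))
    have hb1 : ‖∏ j ∈ s, b j‖ ≤ 1 := by
      rw [norm_prod]
      exact Finset.prod_le_one (fun _ _ => norm_nonneg _)
        fun j hj => hb j (Finset.mem_insert_of_mem hj)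
    have ha1 := ha i (Finset.mem_insert_self i s)
    calc ‖a i * ∏ j ∈ s, a j - b i * ∏ j ∈ s, b j‖
        = ‖(a i - b i) * ∏ j ∈ s, b j + a i * (∏ j ∈ s, a j - ∏ j ∈ s, b j)‖ := by
          congr 1; ring
      _ ≤ ‖a i - b i‖ * ‖∏ j ∈ s, b j‖ + ‖a i‖ * ‖∏ j ∈ s, a j - ∏ j ∈ s, b j‖ := by
          rw [← norm_mul, ← norm_mul]; exact norm_add_le _ _
      _ ≤ ‖a i - b i‖ * 1 + 1 * ∑ j ∈ s, ‖a j - b j‖ := by gcongr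
      _ = _ := by ring

/-- The second order Taylor remainder of `s ↦ exp (i s)` at `0`. -/
noncomputable def expRem (s : ℝ) : ℂ := Complex.exp (Complex.I * s) - 1 - Complex.I * s

theorem continuous_expRem : Continuous expRem := by
  unfold expRem; fun_prop

theorem norm_expRem_le (s : ℝ) : ‖expRem s‖ ≤ 2 * s ^ 2 := by
  have hs : ‖Complex.I * (s : ℂ)‖ = |s| := by simp
  rcases le_total |s| 1 with h | h
  · have h1 := Complex.norm_exp_sub_one_sub_id_le (x := Complex.I * s) (by rw [hs]; exact h)
    rw [hs, sq_abs] at h1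
    unfold expRem
    nlinarith [sq_nonneg s]
  · have h1 : ‖Complex.exp (Complex.I * s) - 1‖ ≤ |s| := Real.norm_exp_I_mul_ofReal_sub_one_le
    have h2 := norm_sub_le (Complex.exp (Complex.I * s) - 1) (Complex.I * s)
    unfold expRem
    rw [hs] at h2
    nlinarith [sq_abs s]

/-- Every term is of second order in `(s, u)`: when both are multiples of t, the bound keeps the
factor `t ^ 2` needed for summation against `m_j ^ 2`. -/
theorem norm_expRem_add_sub_le (s u : ℝ) :
    ‖expRem (u + s) - expRem u‖ ≤ 2 * s ^ 2 + |s| * |u| := by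
  have h : expRem (u + s) - expRem u = Complex.exp (Complex.I * u) * expRem s
      + Complex.I * s * (Complex.exp (Complex.I * u) - 1) := by
    simp only [expRem, Complex.ofReal_add, mul_add, Complex.exp_add]; ring
  rw [h]
  have h1 : ‖Complex.exp (Complex.I * u)‖ = 1 := by
    rw [mul_comm]; exact Complex.norm_exp_ofReal_mul_I u
  have h2 : ‖Complex.exp (Complex.I * u) - 1‖ ≤ |u| := Real.norm_exp_I_mul_ofReal_sub_one_le
  calc _ ≤ ‖Complex.exp (Complex.I * u) * expRem s‖
      + ‖Complex.I * s * (Complex.exp (Complex.I * u) - 1)‖ := norm_add_le _ _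
    _ = ‖expRem s‖ + |s| * ‖Complex.exp (Complex.I * u) - 1‖ := by
        rw [norm_mul, h1, one_mul, norm_mul, norm_mul]; simp
    _ ≤ _ := by gcongr; exact norm_expRem_le s

/-! ### A quantitative law of large numbers in mean -/

section Average

variable {Ω : Type*} [MeasurableSpace Ω] {P : Measure Ω} {ν : Measure ℝ} {n : ℕ}
  {X : Fin n → Ω → ℝ}

theorem integrable_comp_of_hasLaw {Y : Ω → ℝ} (h : HasLaw Y ν P) {f : ℝ → ℝ}
    (hf : Integrable f ν) : Integrable (fun ω => f (Y ω)) P := by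
  have : Integrable f (P.map Y) := by rw [h.map_eq]; exact hf
  exact this.comp_aemeasurable h.aemeasurable

theorem integral_average (hn : 0 < n) (hlaw : ∀ i, HasLaw (X i) ν P) {f : ℝ → ℝ}
    (hf : Integrable f ν) : ∫ ω, (∑ i, f (X i ω)) / n ∂P = ∫ x, f x ∂ν := by
  rw [integral_div, integral_finsetSum _ fun i _ => integrable_comp_of_hasLaw (hlaw i) hf]
  have h : ∀ i, ∫ ω, f (X i ω) ∂P = ∫ x, f x ∂ν := fun i =>
    (hlaw i).integral_comp hf.aestronglyMeasurable
  simp only [h, Finset.sum_const, Finset.card_univ, Fintype.card_fin, nsmul_eq_mul]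
  field_simp

variable [IsProbabilityMeasure P]

theorem memLp_average_sub (hlaw : ∀ i, HasLaw (X i) ν P)
    {f : ℝ → ℝ} (hf : MemLp f 2 ν) (c : ℝ) :
    MemLp (fun ω => (∑ i, f (X i ω)) / n - c) 2 P := by
  have h : ∀ i, MemLp (fun ω => f (X i ω)) 2 P := fun i => by
    have : MemLp f 2 (P.map (X i)) := by rw [(hlaw i).map_eq]; exact hf
    exact this.comp_of_map (hlaw i).aemeasurable
  have h2 : MemLp (fun ω => (∑ i, f (X i ω)) * (n : ℝ)⁻¹) 2 P :=
    (memLp_finsetSum _ fun i _ => h i).mul_const _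
  simpa only [div_eq_mul_inv] using! h2.sub (memLp_const c)

variable [IsProbabilityMeasure ν]

theorem integral_sq_average_sub_le (hn : 0 < n) (hind : iIndepFun X P)
    (hlaw : ∀ i, HasLaw (X i) ν P) {f : ℝ → ℝ} (hfm : Measurable f) (hf : MemLp f 2 ν) :
    ∫ ω, ((∑ i, f (X i ω)) / n - ∫ x, f x ∂ν) ^ 2 ∂P ≤ (∫ x, f x ^ 2 ∂ν) / n := by
  have hfint : Integrable f ν := hf.integrable (by norm_num)
  have h : ∀ i, MemLp (fun ω => f (X i ω)) 2 P := fun i => by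
    have : MemLp f 2 (P.map (X i)) := by rw [(hlaw i).map_eq]; exact hf
    exact this.comp_of_map (hlaw i).aemeasurable
  have hsum : MemLp (fun ω => (∑ i, f (X i ω)) / n) 2 P := by
    simpa using memLp_average_sub hlaw hf 0
  have hvar := variance_eq_integral hsum.1.aemeasurable
  rw [integral_average hn hlaw hfint] at hvar
  rw [← hvar]
  have h1 : (fun ω => (∑ i, f (X i ω)) / (n : ℝ))
      = fun ω => (n : ℝ)⁻¹ * (∑ i, fun ω => f (X i ω)) ω := by
    funext ω; simp [div_eq_inv_mul]
  rw [h1, variance_const_mul, IndepFun.variance_sum (fun i _ => h i)]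
  · have h2 : ∀ i, Var[fun ω => f (X i ω); P] ≤ ∫ x, f x ^ 2 ∂ν := fun i => by
      have h3 := variance_le_expectation_sq (h i).1
      have h4 := (hlaw i).integral_comp (f := fun x => f x ^ 2)
        (hfm.pow_const 2).aestronglyMeasurable
      calc _ ≤ _ := h3
        _ = _ := h4
    have h5 : ∑ i, Var[fun ω => f (X i ω); P] ≤ n * ∫ x, f x ^ 2 ∂ν := by
      refine (Finset.sum_le_sum fun i _ => h2 i).trans_eq ?_
      simp
    have hn' : (0 : ℝ) < n := by exact_mod_cast hn
    calc _ ≤ ((n : ℝ)⁻¹) ^ 2 * (n * ∫ x, f x ^ 2 ∂ν) := by gcongr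
      _ = _ := by field_simp
  · intro i _ j _ hij
    exact (hind.indepFun hij).comp hfm hfm

theorem integral_abs_average_sub_le_of_bounded (hn : 0 < n) (hind : iIndepFun X P)
    (hlaw : ∀ i, HasLaw (X i) ν P) {f : ℝ → ℝ} (hfm : Measurable f) {B : ℝ} (hB : 0 ≤ B)
    (hf : ∀ x, |f x| ≤ B) :
    ∫ ω, |(∑ i, f (X i ω)) / n - ∫ x, f x ∂ν| ∂P ≤ B / √n := by
  have hmem : MemLp f 2 ν := MemLp.of_bound hfm.aestronglyMeasurable B
    (Eventually.of_forall hf)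
  set U : Ω → ℝ := fun ω => (∑ i, f (X i ω)) / n - ∫ x, f x ∂ν
  have hU : MemLp U 2 P := memLp_average_sub hlaw hmem _
  have hn' : (0 : ℝ) < n := by exact_mod_cast hn
  have h1 : ∫ ω, U ω ^ 2 ∂P ≤ B ^ 2 / n := by
    refine (integral_sq_average_sub_le hn hind hlaw hfm hmem).trans ?_
    gcongr
    calc ∫ x, f x ^ 2 ∂ν ≤ ∫ _, B ^ 2 ∂ν := by
          refine integral_mono hmem.integrable_sq (integrable_const _) fun x => ?_
          exact sq_le_sq' (abs_le.1 (hf x)).1 (abs_le.1 (hf x)).2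
      _ = B ^ 2 := by simp
  have h2 := variance_nonneg (fun ω => |U ω|) P
  have hUabs : MemLp (fun ω => |U ω|) 2 P := hU.abs
  rw [variance_eq_sub hUabs] at h2
  have h3 : ∫ ω, ((fun ω => |U ω|) ^ 2) ω ∂P = ∫ ω, U ω ^ 2 ∂P := by simp
  rw [h3] at h2
  refine abs_le_of_sq_le_sq' ?_ (by positivity) |>.2
  rw [div_pow, Real.sq_sqrt hn'.le]
  linarith

/-- Truncation: the part of f off S is bounded and obeys the variance estimate. The part on S is
controlled only in mean; it enters once through the average and once through the integral, whence `2
* η`. -/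
theorem integral_abs_average_sub_le (hn : 0 < n) (hind : iIndepFun X P)
    (hlaw : ∀ i, HasLaw (X i) ν P) {f : ℝ → ℝ} (hfm : Measurable f) (hf : Integrable f ν)
    {S : Set ℝ} (hS : MeasurableSet S) {B η : ℝ} (hB : 0 ≤ B) (hfS : ∀ x ∉ S, |f x| ≤ B)
    (hη : ∫ x in S, |f x| ∂ν ≤ η) :
    ∫ ω, |(∑ i, f (X i ω)) / n - ∫ x, f x ∂ν| ∂P ≤ B / √n + 2 * η := by
  set g : ℝ → ℝ := Sᶜ.indicator f
  set k : ℝ → ℝ := S.indicator f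
  have hg : Integrable g ν := hf.indicator hS.compl
  have hk : Integrable k ν := hf.indicator hS
  have hfgk : ∀ x, f x = g x + k x := fun x => by
    rw [← Set.indicator_compl_add_self S f]; rfl
  have havg : ∀ {q : ℝ → ℝ}, Integrable q ν →
      Integrable (fun ω => (∑ i, q (X i ω)) / (n : ℝ)) P := fun hq =>
    (integrable_finsetSum _ fun i _ => integrable_comp_of_hasLaw (hlaw i) hq).div_const _
  have hgb := integral_abs_average_sub_le_of_bounded hn hind hlaw (hfm.indicator hS.compl) hB
    (f := g) fun x => by
      by_cases hx : x ∈ S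
      · simp [g, hx, hB]
      · simpa [g, hx] using hfS x hx
  have hkabs : ∫ x, |k x| ∂ν = ∫ x in S, |f x| ∂ν := by
    rw [← integral_indicator hS]
    refine integral_congr_ae (Eventually.of_forall fun x => ?_)
    by_cases hx : x ∈ S <;> simp [k, hx]
  have hkavg : ∫ ω, (∑ i, |k (X i ω)|) / n ∂P = ∫ x, |k x| ∂ν :=
    integral_average hn hlaw (f := fun x => |k x|) hk.abs
  have hkint : |∫ x, k x ∂ν| ≤ ∫ x, |k x| ∂ν := abs_integral_le_integral_abs
  have hpt : ∀ ω, |(∑ i, f (X i ω)) / n - ∫ x, f x ∂ν|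
      ≤ |(∑ i, g (X i ω)) / n - ∫ x, g x ∂ν| + (∑ i, |k (X i ω)|) / n + |∫ x, k x ∂ν| := by
    intro ω
    have e1 : ∫ x, f x ∂ν = ∫ x, g x ∂ν + ∫ x, k x ∂ν := by
      rw [← integral_add hg hk]; exact integral_congr_ae (Eventually.of_forall hfgk)
    have e2 : ∑ i, f (X i ω) = ∑ i, g (X i ω) + ∑ i, k (X i ω) := by
      rw [← Finset.sum_add_distrib]; exact Finset.sum_congr rfl fun i _ => hfgk _
    have e3 : |(∑ i, k (X i ω)) / (n : ℝ)| ≤ (∑ i, |k (X i ω)|) / n := by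
      rw [abs_div, Nat.abs_cast]
      gcongr
      exact Finset.abs_sum_le_sum_abs _ _
    rw [e1, e2]
    calc _ = |((∑ i, g (X i ω)) / n - ∫ x, g x ∂ν) + ((∑ i, k (X i ω)) / n
          + -∫ x, k x ∂ν)| := by congr 1; ring
      _ ≤ _ := abs_add_le _ _
      _ ≤ _ := by
        have := abs_add_le ((∑ i, k (X i ω)) / (n : ℝ)) (-∫ x, k x ∂ν)
        rw [abs_neg] at this
        linarith
  have hgI : Integrable (fun ω => |(∑ i, g (X i ω)) / (n : ℝ) - ∫ x, g x ∂ν|) P :=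
    ((havg hg).sub (integrable_const _)).abs
  have hkI : Integrable (fun ω => (∑ i, |k (X i ω)|) / (n : ℝ)) P :=
    havg (q := fun x => |k x|) hk.abs
  calc _ ≤ ∫ ω, (|(∑ i, g (X i ω)) / n - ∫ x, g x ∂ν| + (∑ i, |k (X i ω)|) / n
        + |∫ x, k x ∂ν|) ∂P :=
        integral_mono ((havg hf).sub (integrable_const _)).abs
          ((hgI.add hkI).add (integrable_const _)) hpt
    _ = ∫ ω, |(∑ i, g (X i ω)) / n - ∫ x, g x ∂ν| ∂P + ∫ x, |k x| ∂ν + |∫ x, k x ∂ν| := by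
        rw [integral_add (by exact hgI.add hkI) (integrable_const _), integral_add hgI hkI, hkavg]
        simp
    _ ≤ _ := by linarith

end Average

/-! ### Uniform integrability over compact sets -/

namespace FiniteVarDist

instance (F : FiniteVarDist) : IsProbabilityMeasure F.law := F.isProb

theorem continuous_integral (γ : QuadTestFun) :
    Continuous fun F : FiniteVarDist => ∫ x, γ.1 x ∂F.law :=
  (continuous_apply (A := fun _ : QuadTestFun => ℝ) γ).comp
    (continuous_induced_dom (f := fun (F : FiniteVarDist) (γ : QuadTestFun) => ∫ x, γ.1 x ∂F.law))

theorem integrable_id (F : FiniteVarDist) : Integrable (fun x : ℝ => x) F.law := by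
  refine (F.sq_integrable.add (integrable_const 1)).mono' (by fun_prop)
    (Eventually.of_forall fun x => ?_)
  simp only [Pi.add_apply, Real.norm_eq_abs]
  nlinarith [sq_abs x, sq_nonneg (|x| - 1), abs_nonneg x]

theorem integrable_sub_sq (F : FiniteVarDist) (c : ℝ) :
    Integrable (fun x : ℝ => (x - c) ^ 2) F.law := by
  have h : (fun x : ℝ => (x - c) ^ 2) = fun x => x ^ 2 - 2 * c * x + c ^ 2 := by
    funext x; ring
  rw [h]
  exact (F.sq_integrable.sub (F.integrable_id.const_mul _)).add (integrable_const _)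

theorem integral_sub_mean_sq (F : FiniteVarDist) :
    ∫ x, (x - ∫ y, y ∂F.law) ^ 2 ∂F.law = ∫ x, x ^ 2 ∂F.law - (∫ y, y ∂F.law) ^ 2 := by
  set μ := ∫ y, y ∂F.law with hμ
  have h : (fun x : ℝ => (x - μ) ^ 2) = fun x => x ^ 2 - 2 * μ * x + μ ^ 2 := by
    funext x; ring
  rw [h, integral_add (by exact F.sq_integrable.sub (F.integrable_id.const_mul _)) (integrable_const _),
    integral_sub F.sq_integrable (F.integrable_id.const_mul _), integral_const_mul, ← hμ]
  simp; ring

/-- The part of `x ^ 2` above the level `R ^ 2`. -/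
noncomputable def sqExcess (R : ℕ) : QuadTestFun :=
  ⟨fun x => max (x ^ 2 - (R : ℝ) ^ 2) 0, by fun_prop, 1, fun x => by
    rw [abs_of_nonneg (by positivity), div_le_one (by positivity)]
    exact max_le (by nlinarith [sq_nonneg (R : ℝ)]) (by positivity)⟩

theorem sqExcess_nonneg (R : ℕ) (x : ℝ) : 0 ≤ (sqExcess R).1 x := le_max_right _ _

theorem sqExcess_le (R : ℕ) (x : ℝ) : (sqExcess R).1 x ≤ x ^ 2 :=
  max_le (by nlinarith [sq_nonneg (R : ℝ)]) (sq_nonneg x)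

theorem continuous_sqExcess (R : ℕ) : Continuous (sqExcess R).1 := (sqExcess R).2.1

theorem integrable_sqExcess (R : ℕ) (F : FiniteVarDist) :
    Integrable (sqExcess R).1 F.law :=
  F.sq_integrable.mono' (continuous_sqExcess R).aestronglyMeasurable
    (Eventually.of_forall fun x => by
      rw [Real.norm_of_nonneg (sqExcess_nonneg R x)]; exact sqExcess_le R x)

theorem sqExcess_antitone {R S : ℕ} (h : R ≤ S) (x : ℝ) :
    (sqExcess S).1 x ≤ (sqExcess R).1 x := by
  refine max_le_max ?_ le_rfl
  gcongr

theorem tendsto_integral_sqExcess (F : FiniteVarDist) :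
    Tendsto (fun R => ∫ x, (sqExcess R).1 x ∂F.law) atTop (𝓝 0) := by
  have h := tendsto_integral_of_dominated_convergence (μ := F.law)
    (F := fun R => (sqExcess R).1) (f := fun _ => (0 : ℝ)) (fun x => x ^ 2)
    (fun R => (continuous_sqExcess R).aestronglyMeasurable) F.sq_integrable
    (fun R => Eventually.of_forall fun x => by
      rw [Real.norm_of_nonneg (sqExcess_nonneg R x)]; exact sqExcess_le R x)
    (Eventually.of_forall fun x => by
      refine tendsto_const_nhds.congr' ?_
      obtain ⟨N, hN⟩ := exists_nat_ge |x|
      filter_upwards [eventually_ge_atTop N] with R hR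
      have hR' : |x| ≤ R := hN.trans (by exact_mod_cast hR)
      refine (max_eq_right ?_).symm
      have := sq_le_sq' (by linarith [abs_nonneg x]) hR'
      rw [sq_abs] at this
      linarith)
  simpa using h

/-- A Dini argument: the excess is a continuous test function, so its integral is continuous in F,
and it decreases to 0 as R grows. The sublevel sets are thus an increasing open cover of the compact
set, and one of them contains it. -/
theorem exists_integral_sqExcess_lt {Δ₀ : Set FiniteVarDist} (h : IsCompact Δ₀) {ε : ℝ}
    (hε : 0 < ε) : ∃ R : ℕ, ∀ F ∈ Δ₀, ∫ x, (sqExcess R).1 x ∂F.law < ε := by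
  obtain ⟨R, hR⟩ := h.elim_directed_cover
    (fun R : ℕ => {F : FiniteVarDist | ∫ x, (sqExcess R).1 x ∂F.law < ε})
    (fun R => isOpen_lt (continuous_integral _) continuous_const)
    (fun F _ => by
      obtain ⟨R, hR⟩ := ((tendsto_integral_sqExcess F).eventually_lt_const hε).exists
      exact Set.mem_iUnion.2 ⟨R, hR⟩)
    (directed_of_isDirected_le fun R S hRS F hF =>
      lt_of_le_of_lt (integral_mono (integrable_sqExcess S F) (integrable_sqExcess R F)
        (sqExcess_antitone hRS)) hF)
  exact ⟨R, fun F hF => hR hF⟩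

theorem exists_integral_sq_le {Δ₀ : Set FiniteVarDist} (h : IsCompact Δ₀) :
    ∃ M : ℝ, 0 ≤ M ∧ ∀ F ∈ Δ₀, ∫ x, x ^ 2 ∂F.law ≤ M := by
  obtain ⟨R, hR⟩ := exists_integral_sqExcess_lt h one_pos
  refine ⟨R ^ 2 + 1, by positivity, fun F hF => ?_⟩
  have h1 : ∫ x, x ^ 2 ∂F.law ≤ ∫ x, ((R : ℝ) ^ 2 + (sqExcess R).1 x) ∂F.law :=
    integral_mono F.sq_integrable ((integrable_const _).add (integrable_sqExcess R F)) fun x => by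
      have : x ^ 2 - (R : ℝ) ^ 2 ≤ (sqExcess R).1 x := le_max_left _ _
      simp only; linarith
  rw [integral_add (integrable_const _) (integrable_sqExcess R F)] at h1
  have := hR F hF
  simp at h1
  linarith

/-- The centred squares are uniformly integrable over a compact set of distributions. -/
theorem exists_setIntegral_sub_mean_sq_le {Δ₀ : Set FiniteVarDist} (h : IsCompact Δ₀) {ε : ℝ}
    (hε : 0 < ε) : ∃ K : ℝ, 0 ≤ K ∧ ∀ F ∈ Δ₀,
      ∫ x in {x | K < |x - ∫ y, y ∂F.law|}, (x - ∫ y, y ∂F.law) ^ 2 ∂F.law ≤ ε := by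
  obtain ⟨M, hM, hFM⟩ := exists_integral_sq_le h
  obtain ⟨R₀, hR₀⟩ := exists_integral_sqExcess_lt h (ε := ε / (4 * (1 + M))) (by positivity)
  set R := R₀ + 1
  have hR1 : (1 : ℝ) ≤ R := by simp [R]
  -- As `|μ| ≤ √M`, this threshold forces `|x| > 2 * R`, so `x ^ 2` is at most twice its excess over
  -- `R ^ 2`. The choice `R ≥ 1` gives `x ^ 2 ≥ 1`, which lets `μ ^ 2 ≤ M` be absorbed into `M * x ^
  -- 2`.
  refine ⟨2 * R + √M, by positivity, fun F hF => ?_⟩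
  set μ := ∫ y, y ∂F.law with hμ
  have hμM : μ ^ 2 ≤ M := by
    have h1 := F.integral_sub_mean_sq
    have h2 : 0 ≤ ∫ x, (x - ∫ y, y ∂F.law) ^ 2 ∂F.law := integral_nonneg fun x => sq_nonneg _
    linarith [hFM F hF]
  have hμabs : |μ| ≤ √M := Real.abs_le_sqrt hμM
  have hS : MeasurableSet {x : ℝ | 2 * R + √M < |x - μ|} :=
    measurableSet_lt measurable_const (by fun_prop)
  rw [← integral_indicator hS]
  have hpt : ∀ x, {x : ℝ | 2 * R + √M < |x - μ|}.indicator (fun x => (x - μ) ^ 2) x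
      ≤ 4 * (1 + M) * (sqExcess R).1 x := fun x => by
    by_cases hx : x ∈ {x : ℝ | 2 * R + √M < |x - μ|}
    · rw [Set.indicator_of_mem hx]
      have hx' : 2 * R + √M < |x - μ| := hx
      have h1 : 2 * (R : ℝ) < |x| := by linarith [abs_sub x μ]
      have h2 : 4 * (R : ℝ) ^ 2 ≤ x ^ 2 := by
        rw [← sq_abs x]; nlinarith
      have h3 : x ^ 2 ≤ 2 * (sqExcess R).1 x := by
        have : x ^ 2 - (R : ℝ) ^ 2 ≤ (sqExcess R).1 x := le_max_left _ _
        nlinarith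
      have h4 : 1 ≤ x ^ 2 := by nlinarith
      have h5 : (x - μ) ^ 2 ≤ 2 * (1 + M) * x ^ 2 := by
        nlinarith [sq_nonneg (x + μ), mul_nonneg hM (sub_nonneg.2 h4)]
      calc _ ≤ _ := h5
        _ ≤ 2 * (1 + M) * (2 * (sqExcess R).1 x) := by gcongr
        _ = _ := by ring
    · rw [Set.indicator_of_notMem hx]
      have := sqExcess_nonneg R x
      positivity
  calc _ ≤ ∫ x, 4 * (1 + M) * (sqExcess R).1 x ∂F.law :=
        integral_mono ((F.integrable_sub_sq μ).indicator hS)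
          ((integrable_sqExcess R F).const_mul _) hpt
    _ = 4 * (1 + M) * ∫ x, (sqExcess R).1 x ∂F.law := integral_const_mul _ _
    _ ≤ 4 * (1 + M) * ∫ x, (sqExcess R₀).1 x ∂F.law := by
        refine mul_le_mul_of_nonneg_left ?_ (by positivity)
        exact integral_mono (integrable_sqExcess R F) (integrable_sqExcess R₀ F)
          (sqExcess_antitone (Nat.le_succ _))
    _ ≤ 4 * (1 + M) * (ε / (4 * (1 + M))) := by
        gcongr
        exact (hR₀ F hF).le
    _ = ε := by field_simp

end FiniteVarDist

/-! ### Factorisation and the pathwise bound -/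

theorem isProbabilityMeasure_empiricalDist {n : ℕ} (hn : 0 < n) (x : Fin n → ℝ) :
    IsProbabilityMeasure (empiricalDist x) := by
  constructor
  have h0 : (n : ℝ≥0∞) ≠ 0 := by exact_mod_cast hn.ne'
  simp [empiricalDist, ENNReal.inv_mul_cancel h0 (ENNReal.natCast_ne_top n)]

theorem integrable_empiricalDist {n : ℕ} (hn : 0 < n) (x : Fin n → ℝ) {E : Type*}
    [NormedAddCommGroup E] (f : ℝ → E) : Integrable f (empiricalDist x) := by
  refine Integrable.smul_measure ?_ (by simpa using hn.ne')
  exact integrable_finsetSum_measure.2 fun i _ => integrable_dirac (by simp)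

theorem integral_empiricalDist {n : ℕ} (x : Fin n → ℝ) {E : Type*}
    [NormedAddCommGroup E] [NormedSpace ℝ E] [CompleteSpace E] (f : ℝ → E) :
    ∫ y, f y ∂(empiricalDist x) = (n : ℝ)⁻¹ • ∑ i, f (x i) := by
  rw [empiricalDist, integral_smul_measure,
    integral_finsetSum_measure fun i _ => integrable_dirac (by simp)]
  simp [integral_dirac]

/-- The centre c is free because the weights sum to zero; it is later taken to be the sample mean
for the empirical law and the true mean for `F.law`. -/
theorem sumCharFun_eq_prod {n : ℕ} (G : Measure ℝ) [IsProbabilityMeasure G] {m : Fin n → ℝ}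
    (hm : ∑ i, m i = 0) (τ c : ℝ) :
    sumCharFun G m τ
      = ∏ j, ∫ x, Complex.exp (Complex.I * ((τ * m j * (x - c) : ℝ) : ℂ)) ∂G := by
  rw [← integral_fintype_prod_eq_prod (𝕜 := ℂ)
    (f := fun j x => Complex.exp (Complex.I * ((τ * m j * (x - c) : ℝ) : ℂ)))]
  refine integral_congr_ae (Eventually.of_forall fun y => ?_)
  simp only
  rw [← Complex.exp_sum, ← Finset.mul_sum, mul_assoc, ← Complex.ofReal_sum,
    ← Complex.ofReal_mul]
  have h : ∑ j, τ * m j * (y j - c) = τ * ∑ j, m j * y j := by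
    simp only [mul_assoc, ← Finset.mul_sum, mul_sub, Finset.sum_sub_distrib, ← Finset.sum_mul,
      hm]
    ring
  rw [h]

theorem integral_exp_eq_one_add (G : Measure ℝ) [IsProbabilityMeasure G]
    (hG : Integrable (fun x : ℝ => x) G) (t : ℝ) :
    ∫ x, Complex.exp (Complex.I * ((t * (x - ∫ y, y ∂G) : ℝ) : ℂ)) ∂G
      = 1 + ∫ x, expRem (t * (x - ∫ y, y ∂G)) ∂G := by
  set c := ∫ y, y ∂G with hc
  have hexp : Integrable (fun x : ℝ => Complex.exp (Complex.I * ((t * (x - c) : ℝ) : ℂ))) G := by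
    refine Integrable.of_bound (by fun_prop) 1 (Eventually.of_forall fun x => ?_)
    rw [mul_comm, Complex.norm_exp_ofReal_mul_I]
  have hlin : Integrable (fun x : ℝ => ((t * (x - c) : ℝ) : ℂ)) G :=
    ((hG.sub (integrable_const c)).const_mul t).ofReal
  have hzero : ∫ x, t * (x - c) ∂G = 0 := by
    rw [integral_const_mul, integral_sub hG (integrable_const c), ← hc]
    simp
  simp only [expRem]
  rw [integral_sub (by exact hexp.sub (integrable_const 1)) (hlin.const_mul _),
    integral_sub hexp (integrable_const 1), integral_const_mul, integral_complex_ofReal, hzero]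
  simp

theorem norm_integral_exp_le_one (G : Measure ℝ) [IsProbabilityMeasure G] (f : ℝ → ℝ) :
    ‖∫ x, Complex.exp (Complex.I * (f x : ℂ)) ∂G‖ ≤ 1 := by
  refine (norm_integral_le_of_norm_le_const (C := 1)
    (Eventually.of_forall fun x => ?_)).trans (by simp)
  rw [mul_comm, Complex.norm_exp_ofReal_mul_I]

/-- The cross term `|b| * |y i|` is split by a weighted arithmetic-geometric inequality. The weight
`√n` suits b the error of the sample mean: `b ^ 2` then has expectation of order `1 / n`, so both
resulting terms are of order `1 / √n`. -/
theorem norm_average_expRem_recenter_le {n : ℕ} (hn : 0 < n) (y : Fin n → ℝ) (t b : ℝ) :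
    ‖(n : ℝ)⁻¹ • ∑ i, expRem (t * (y i - b)) - (n : ℝ)⁻¹ • ∑ i, expRem (t * y i)‖
      ≤ t ^ 2 * ((2 + √n) * b ^ 2 + ((∑ i, y i ^ 2) / n) / √n) := by
  have hn' : (0 : ℝ) < n := by exact_mod_cast hn
  have hs : 0 < √(n : ℝ) := Real.sqrt_pos.2 hn'
  rw [← smul_sub, ← Finset.sum_sub_distrib, norm_smul, Real.norm_of_nonneg (by positivity)]
  have h : ∀ i, ‖expRem (t * (y i - b)) - expRem (t * y i)‖
      ≤ t ^ 2 * ((2 + √n) * b ^ 2 + y i ^ 2 / √n) := fun i => by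
    have h1 := norm_expRem_add_sub_le (-(t * b)) (t * y i)
    rw [show t * y i + -(t * b) = t * (y i - b) by ring] at h1
    refine h1.trans ?_
    have h2 : |b| * |y i| ≤ √n * b ^ 2 + y i ^ 2 / √n := by
      rw [← sub_nonneg]
      have : √n * b ^ 2 + y i ^ 2 / √n - |b| * |y i|
          = ((√n * |b| - |y i|) ^ 2 + √n * (|b| * |y i|)) / √n := by
        rw [← sq_abs b, ← sq_abs (y i)]; field_simp; ring
      rw [this]; positivity
    rw [abs_neg, abs_mul, abs_mul]
    calc 2 * (-(t * b)) ^ 2 + |t| * |b| * (|t| * |y i|)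
        = t ^ 2 * (2 * b ^ 2 + |b| * |y i|) := by rw [← sq_abs t]; nlinarith [sq_abs t]
      _ ≤ t ^ 2 * ((2 + √n) * b ^ 2 + y i ^ 2 / √n) := by
        refine mul_le_mul_of_nonneg_left ?_ (sq_nonneg t)
        linarith
  calc _ ≤ (n : ℝ)⁻¹ * ∑ i, t ^ 2 * ((2 + √n) * b ^ 2 + y i ^ 2 / √n) := by
        gcongr
        exact (norm_sum_le _ _).trans (Finset.sum_le_sum fun i _ => h i)
    _ = _ := by
        rw [← Finset.mul_sum, Finset.sum_add_distrib, ← Finset.sum_div]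
        simp
        field_simp

theorem norm_le_abs_average_sub {n : ℕ} {G : Measure ℝ} {f : ℝ → ℂ} (hf : Integrable f G)
    (x : Fin n → ℝ) :
    ‖(n : ℝ)⁻¹ • ∑ i, f (x i) - ∫ y, f y ∂G‖
      ≤ |(∑ i, (f (x i)).re) / n - ∫ y, (f y).re ∂G|
        + |(∑ i, (f (x i)).im) / n - ∫ y, (f y).im ∂G| := by
  refine (Complex.norm_le_abs_re_add_abs_im _).trans_eq ?_
  have hre : (∫ y, f y ∂G).re = ∫ y, (f y).re ∂G := (integral_re hf).symm
  have him : (∫ y, f y ∂G).im = ∫ y, (f y).im ∂G := (integral_im hf).symm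
  rw [Complex.sub_re, Complex.sub_im, hre, him, Complex.smul_re, Complex.smul_im,
    Complex.re_sum, Complex.im_sum]
  simp only [smul_eq_mul, div_eq_inv_mul]

theorem FiniteVarDist.integrable_expRem (F : FiniteVarDist) (t c : ℝ) :
    Integrable (fun x => expRem (t * (x - c))) F.law := by
  refine ((F.integrable_sub_sq c).const_mul (2 * t ^ 2)).mono'
    (continuous_expRem.comp (by fun_prop)).aestronglyMeasurable
    (Eventually.of_forall fun x => (norm_expRem_le _).trans_eq (by ring))

theorem norm_sumCharFun_empiricalDist_sub_le {n : ℕ} (hn : 0 < n) (F : FiniteVarDist)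
    {μ : ℝ} (hμ : μ = ∫ y, y ∂F.law) {m : Fin n → ℝ} (hm : ∑ i, m i = 0) (τ : ℝ)
    (x : Fin n → ℝ) :
    ‖sumCharFun (empiricalDist x) m τ - sumCharFun F.law m τ‖ ≤ ∑ j,
      ((τ * m j) ^ 2 * ((2 + √n) * ((∑ i, x i) / n - μ) ^ 2
          + ((∑ i, (x i - μ) ^ 2) / n) / √n)
        + (|(∑ i, (expRem (τ * m j * (x i - μ))).re) / n
            - ∫ y, (expRem (τ * m j * (y - μ))).re ∂F.law|
          + |(∑ i, (expRem (τ * m j * (x i - μ))).im) / n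
            - ∫ y, (expRem (τ * m j * (y - μ))).im ∂F.law|)) := by
  have := isProbabilityMeasure_empiricalDist hn x
  have hmean : ∫ y, y ∂(empiricalDist x) = (∑ i, x i) / n := by
    rw [integral_empiricalDist, smul_eq_mul, div_eq_inv_mul]
  rw [sumCharFun_eq_prod _ hm τ (∫ y, y ∂(empiricalDist x)), sumCharFun_eq_prod F.law hm τ μ]
  refine (norm_prod_sub_prod_le _ _ _ (fun j _ => norm_integral_exp_le_one _ _)
    fun j _ => norm_integral_exp_le_one _ _).trans (Finset.sum_le_sum fun j _ => ?_)
  rw [integral_exp_eq_one_add _ (integrable_empiricalDist hn x _), hμ,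
    integral_exp_eq_one_add _ F.integrable_id, ← hμ, add_sub_add_left_eq_sub,
    integral_empiricalDist, hmean]
  have h1 := norm_average_expRem_recenter_le hn (fun i => x i - μ) (τ * m j)
    ((∑ i, x i) / n - μ)
  have h2 := norm_le_abs_average_sub (F.integrable_expRem (τ * m j) μ) x
  simp only [sub_sub_sub_cancel_right] at h1
  calc _ ≤ _ := norm_sub_le_norm_sub_add_norm_sub _ _ _
    _ ≤ _ := add_le_add h1 h2

/-! ### Bounds in expectation -/

section Expectation

variable {Ω : Type*} [MeasurableSpace Ω] {P : Measure Ω} [IsProbabilityMeasure P]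

theorem integral_abs_average_sub_le_of_quadratic {n : ℕ} (hn : 0 < n) {X : Fin n → Ω → ℝ}
    (hind : iIndepFun X P) (F : FiniteVarDist) (hlaw : ∀ i, HasLaw (X i) F.law P) {f : ℝ → ℝ}
    (hf : Continuous f) {C μ K η : ℝ} (hC : 0 ≤ C) (hfC : ∀ x, |f x| ≤ C * (x - μ) ^ 2)
    (hK : ∫ x in {x | K < |x - μ|}, (x - μ) ^ 2 ∂F.law ≤ η) :
    Integrable (fun ω => |(∑ i, f (X i ω)) / n - ∫ x, f x ∂F.law|) P ∧
    ∫ ω, |(∑ i, f (X i ω)) / n - ∫ x, f x ∂F.law| ∂P ≤ C * (K ^ 2 / √n + 2 * η) := by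
  have hq := (F.integrable_sub_sq μ).const_mul C
  have hfint : Integrable f F.law :=
    hq.mono' hf.aestronglyMeasurable (Eventually.of_forall hfC)
  refine ⟨(((integrable_finsetSum _ fun i _ =>
    integrable_comp_of_hasLaw (hlaw i) hfint).div_const _).sub (integrable_const _)).abs, ?_⟩
  have hS : MeasurableSet {x : ℝ | K < |x - μ|} := measurableSet_lt measurable_const (by fun_prop)
  refine (integral_abs_average_sub_le hn hind hlaw hf.measurable hfint hS (B := C * K ^ 2)
    (η := C * η) (by positivity) (fun x hx => (hfC x).trans ?_) ?_).trans_eq (by ring)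
  · have hx' : |x - μ| ≤ K := not_lt.1 hx
    rw [← sq_abs]
    gcongr
  · calc _ ≤ ∫ x in {x | K < |x - μ|}, C * (x - μ) ^ 2 ∂F.law :=
          integral_mono hfint.abs.integrableOn hq.integrableOn hfC
      _ = C * ∫ x in {x | K < |x - μ|}, (x - μ) ^ 2 ∂F.law := integral_const_mul _ _
      _ ≤ C * η := by gcongr

/-- Passing to an integrable majorant B lets Markov's inequality be applied without any
measurability of the difference itself. -/
theorem exists_integrable_bound_sumCharFun_sub {n : ℕ} (hn : 0 < n) {X : Fin n → Ω → ℝ}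
    (hind : iIndepFun X P) (F : FiniteVarDist) (hlaw : ∀ i, HasLaw (X i) F.law P)
    {m : Fin n → ℝ} (hm : ∑ i, m i = 0) (τ : ℝ) {δ M K η : ℝ} (hmδ : ∑ i, m i ^ 2 ≤ δ ^ 2)
    (hM : ∫ x, x ^ 2 ∂F.law ≤ M) (hη : 0 ≤ η)
    (hK : ∫ x in {x | K < |x - ∫ y, y ∂F.law|}, (x - ∫ y, y ∂F.law) ^ 2 ∂F.law ≤ η) :
    ∃ B : Ω → ℝ, Integrable B P ∧
      (∀ ω, ‖sumCharFun (empiricalDist fun i => X i ω) m τ - sumCharFun F.law m τ‖ ≤ B ω) ∧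
      ∫ ω, B ω ∂P ≤ τ ^ 2 * δ ^ 2 * ((4 * M + 4 * K ^ 2) / √n + 8 * η) := by
  set μ := ∫ y, y ∂F.law with hμ
  have hn' : (0 : ℝ) < n := by exact_mod_cast hn
  have hs : 0 < √(n : ℝ) := Real.sqrt_pos.2 hn'
  have hM0 : 0 ≤ M := (integral_nonneg fun x => sq_nonneg x).trans hM
  have hvar : ∫ x, (x - μ) ^ 2 ∂F.law ≤ M := by
    rw [hμ, F.integral_sub_mean_sq]; nlinarith [sq_nonneg μ]
  have hid : MemLp (fun x : ℝ => x) 2 F.law :=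
    (memLp_two_iff_integrable_sq (by fun_prop)).2 F.sq_integrable
  have hmeanI : Integrable (fun ω => ((∑ i, X i ω) / n - μ) ^ 2) P :=
    (memLp_average_sub hlaw hid μ).integrable_sq
  have hmean : ∫ ω, ((∑ i, X i ω) / n - μ) ^ 2 ∂P ≤ M / n := by
    refine (integral_sq_average_sub_le hn hind hlaw measurable_id hid).trans ?_
    gcongr
    exact hM
  have hsqI : Integrable (fun ω => (∑ i, (X i ω - μ) ^ 2) / n) P :=
    (integrable_finsetSum _ fun i _ =>
      integrable_comp_of_hasLaw (hlaw i) (F.integrable_sub_sq μ)).div_const _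
  have hsq : ∫ ω, (∑ i, (X i ω - μ) ^ 2) / n ∂P ≤ M :=
    (integral_average hn hlaw (F.integrable_sub_sq μ)).trans_le hvar
  have hre := fun t : ℝ => integral_abs_average_sub_le_of_quadratic hn hind F hlaw
    (f := fun x => (expRem (t * (x - μ))).re) (C := 2 * t ^ 2)
    (Complex.continuous_re.comp (continuous_expRem.comp (by fun_prop))) (by positivity)
    (fun x => (Complex.abs_re_le_norm _).trans ((norm_expRem_le _).trans_eq (by ring))) hK
  have him := fun t : ℝ => integral_abs_average_sub_le_of_quadratic hn hind F hlaw
    (f := fun x => (expRem (t * (x - μ))).im) (C := 2 * t ^ 2)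
    (Complex.continuous_im.comp (continuous_expRem.comp (by fun_prop))) (by positivity)
    (fun x => (Complex.abs_im_le_norm _).trans ((norm_expRem_le _).trans_eq (by ring))) hK
  have hQI := (hmeanI.const_mul (2 + √n)).add (hsqI.div_const √n)
  have hQ : ∫ ω, ((2 + √n) * ((∑ i, X i ω) / n - μ) ^ 2
      + ((∑ i, (X i ω - μ) ^ 2) / n) / √n) ∂P ≤ 4 * M / √n := by
    rw [integral_add (hmeanI.const_mul _) (hsqI.div_const _), integral_const_mul, integral_div]
    have h1 : 1 ≤ √(n : ℝ) := Real.one_le_sqrt.2 (by exact_mod_cast hn)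
    -- The constant 3 comes from `2 + √n ≤ 3 * √n`, valid as `n ≥ 1`.
    have h2 : (2 + √n) * (M / n) ≤ 3 * M / √n := by
      have : (2 + √n) * (M / n) = (2 + √n) * M / √n / √n := by
        rw [div_div, Real.mul_self_sqrt hn'.le]; ring
      rw [this]
      gcongr
      rw [div_le_iff₀ hs]
      nlinarith
    calc _ ≤ (2 + √n) * (M / n) + M / √n := by gcongr
      _ ≤ 3 * M / √n + M / √n := by gcongr
      _ = _ := by ring
  have hjI := fun t : ℝ => (hQI.const_mul (t ^ 2)).add ((hre t).1.add (him t).1)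
  refine ⟨_, integrable_finsetSum Finset.univ fun j _ => hjI (τ * m j),
    fun ω => norm_sumCharFun_empiricalDist_sub_le hn F hμ hm τ _, ?_⟩
  rw [integral_finsetSum _ fun j _ => hjI (τ * m j)]
  set A := (4 * M + 4 * K ^ 2) / √n + 8 * η with hA
  have hA0 : 0 ≤ A := by positivity
  have hj : ∀ t : ℝ, ∫ ω, (((t ^ 2) * ((2 + √n) * ((∑ i, X i ω) / n - μ) ^ 2
        + ((∑ i, (X i ω - μ) ^ 2) / n) / √n))
      + (|(∑ i, (expRem (t * (X i ω - μ))).re) / n - ∫ y, (expRem (t * (y - μ))).re ∂F.law|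
        + |(∑ i, (expRem (t * (X i ω - μ))).im) / n
          - ∫ y, (expRem (t * (y - μ))).im ∂F.law|)) ∂P ≤ t ^ 2 * A := fun t => by
    rw [integral_add (by exact hQI.const_mul (t ^ 2)) (by exact (hre t).1.add (him t).1),
      integral_const_mul,
      integral_add (hre t).1 (him t).1]
    calc _ ≤ t ^ 2 * (4 * M / √n) + (2 * t ^ 2 * (K ^ 2 / √n + 2 * η)
          + 2 * t ^ 2 * (K ^ 2 / √n + 2 * η)) :=
          add_le_add (mul_le_mul_of_nonneg_left hQ (sq_nonneg t)) (add_le_add (hre t).2 (him t).2)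
      _ = _ := by rw [hA]; ring
  calc _ ≤ ∑ j, (τ * m j) ^ 2 * A := Finset.sum_le_sum fun j _ => hj (τ * m j)
    _ = τ ^ 2 * (∑ j, m j ^ 2) * A := by
        rw [← Finset.sum_mul, Finset.mul_sum]; simp only [mul_pow]
    _ ≤ _ := by gcongr

end Expectation

/-! ### Convergence in probability -/

theorem corollary2
    (Δ₀ : Set FiniteVarDist) (hΔ₀ : IsCompact Δ₀)
    (F : ℕ → FiniteVarDist) (hF : ∀ n, F n ∈ Δ₀)
    {Ω : ℕ → Type*} [∀ n, MeasurableSpace (Ω n)]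
    (P : ∀ n, Measure (Ω n)) [∀ n, IsProbabilityMeasure (P n)]
    (X : ∀ n, Fin n → Ω n → ℝ)
    (hXindep : ∀ n, iIndepFun (X n) (P n))
    (hXlaw : ∀ n, ∀ i, HasLaw (X n i) (F n).law (P n))
    (δ : ℝ) (m : ∀ n, Fin n → ℝ)
    (hm_mean : ∀ n, (∑ i, m n i) / (n : ℝ) = 0)
    (hm_sq : ∀ n, ∑ i, (m n i) ^ 2 ≤ δ ^ 2)
    (τ : ℝ) :
    TendstoZeroInProb P (fun n ω =>
      sumCharFun (empiricalDist fun i => X n i ω) (m n) τ -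
        sumCharFun (F n).law (m n) τ) := by
  intro ε hε
  rw [ENNReal.tendsto_nhds_zero]
  intro e he
  rcases eq_or_ne e ⊤ with rfl | he'
  · exact Eventually.of_forall fun _ => le_top
  set r := e.toReal
  have hr : 0 < r := ENNReal.toReal_pos he.ne' he'
  set A := τ ^ 2 * δ ^ 2
  have hA : 0 ≤ A := by positivity
  obtain ⟨M, hM, hFM⟩ := FiniteVarDist.exists_integral_sq_le hΔ₀
  -- This tolerance makes the tail contribution `8 * A * η` at most `ε * r / 2`; using `A + 1`
  -- covers the case `A = 0`. The other half is left for the term of order `1 / √n`.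
  obtain ⟨K, -, hFK⟩ := FiniteVarDist.exists_setIntegral_sub_mean_sq_le hΔ₀
    (ε := ε * r / (16 * (A + 1))) (by positivity)
  have hlim : Tendsto (fun n : ℕ => A * ((4 * M + 4 * K ^ 2) / √(n : ℝ))) atTop (𝓝 0) := by
    simpa using (tendsto_const_nhds.div_atTop
      (Real.tendsto_sqrt_atTop.comp tendsto_natCast_atTop_atTop)).const_mul A
  filter_upwards [hlim.eventually_lt_const (show 0 < ε * r / 2 by positivity),
    eventually_gt_atTop 0] with n hn hn0
  have hm0 : ∑ i, m n i = 0 := by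
    have h := hm_mean n
    rwa [div_eq_zero_iff, or_iff_left (by exact_mod_cast hn0.ne')] at h
  obtain ⟨B, hBI, hZB, hB⟩ := exists_integrable_bound_sumCharFun_sub hn0 (hXindep n) (F n)
    (hXlaw n) hm0 τ (hm_sq n) (hFM _ (hF n)) (by positivity) (hFK _ (hF n))
  have hBr : ∫ ω, B ω ∂(P n) ≤ ε * r := by
    refine hB.trans ?_
    have h1 : A * (8 * (ε * r / (16 * (A + 1)))) ≤ ε * r / 2 := by
      have : A * (8 * (ε * r / (16 * (A + 1)))) = ε * r / 2 * (A / (A + 1)) := by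
        field_simp; ring
      rw [this]
      exact mul_le_of_le_one_right (by positivity) ((div_le_one (by positivity)).2 (by linarith))
    rw [mul_add]
    linarith
  have hmarkov := mul_meas_ge_le_integral_of_nonneg
    (Eventually.of_forall fun ω => (norm_nonneg _).trans (hZB ω)) hBI ε
  have hreal : (P n).real {ω | ε ≤ B ω} ≤ r := by
    by_contra hcon
    push Not at hcon
    nlinarith
  calc P n _ ≤ P n {ω | ε ≤ B ω} := measure_mono fun ω hω => le_trans hω (hZB ω)
    _ = ENNReal.ofReal ((P n).real {ω | ε ≤ B ω}) := by simp
    _ ≤ ENNReal.ofReal r := ENNReal.ofReal_le_ofReal hreal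
    _ = e := ENNReal.ofReal_toReal he'
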